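/- Let $G$ be an infinite finitely generated group and let $A$ be a finite set with $|A| = m^k$ for some integers $m \ge 5$ and $k \ge 4$. Let $X = A^G$ carry the product topology (with $A$ discrete), and let $G$ act on $X$ by the shift maps $\sigma_g(x)_a = x_{ag}$. Let $\mathrm{Homeo}(X)$ be the group of self-homeomorphisms of $X$, let $\mathrm{Aut}(X)$ be the subgroup of those homeomorphisms that commute with every shift map $\sigma_g$, $g \in G$, and write $G$ also for the subgroup $\{\sigma_g : g \in G\}$ of $\mathrm{Homeo}(X)$. Then there is a finitely generated subgroup $H$ of $\mathrm{Aut}(X)$ such that the centralizer of $H$ in $\mathrm{Homeo}(X)$ is exactly the group of shifts: $C_{\mathrm{Homeo}(X)}(H) = G$. In particular, $C_{\mathrm{Aut}(X)}(H) = G \cap \mathrm{Aut}(X)$ (for abelian $G$, this is $G$ itself). -/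

import Mathlib

/-- The shift map `σ_g` on the full shift `A^G`, given by `σ_g(x)_a = x_{ag}`,
as a self-homeomorphism of `A^G` with the product topology. -/
def shiftMap {G : Type*} [Group G] {A : Type*} [TopologicalSpace A] (g : G) :
    (G → A) ≃ₜ (G → A) where
  toFun x := fun a => x (a * g)
  invFun x := fun a => x (a * g⁻¹)
  left_inv x := by
    funext a
    simp
  right_inv x := by
    funext a
    simp
  continuous_toFun := continuous_pi fun a => continuous_apply (a * g)
  continuous_invFun := continuous_pi fun a => continuous_apply (a * g⁻¹)

/-- The shift action of `G` on `A^G`, as a homomorphism `G → Homeo(A^G)`. -/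
def shiftHom (G : Type*) [Group G] (A : Type*) [TopologicalSpace A] :
    G →* ((G → A) ≃ₜ (G → A)) where
  toFun g := shiftMap g
  map_one' := by
    ext x a
    simp [shiftMap]
  map_mul' g h := by
    ext x a
    simp [shiftMap, mul_assoc]

/-- The group of shifts: the copy of `G` inside `Homeo(A^G)`. -/
def shiftGroup (G : Type*) [Group G] (A : Type*) [TopologicalSpace A] :
    Subgroup ((G → A) ≃ₜ (G → A)) :=
  (shiftHom G A).range

/-- The automorphism group `Aut(A^G, G)`: the self-homeomorphisms of `A^G` that commute with
every shift map. -/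
def shiftAut (G : Type*) [Group G] (A : Type*) [TopologicalSpace A] :
    Subgroup ((G → A) ≃ₜ (G → A)) where
  carrier := {φ | ∀ (g : G) (x : G → A), φ (shiftMap g x) = shiftMap g (φ x)}
  one_mem' := fun _ _ => rfl
  mul_mem' := by
    intro φ ψ hφ hψ g x
    simp only [Set.mem_ofPred_eq] at hφ hψ
    simp [hφ, hψ]
  inv_mem' := by
    intro φ hφ g x
    apply φ.injective
    rw [hφ g (φ⁻¹ x)]
    change φ (φ.symm (shiftMap g x)) = shiftMap g (φ (φ.symm x))
    rw [φ.apply_symm_apply, φ.apply_symm_apply]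

/-!
The alphabet is written as a product `A ≃ P × Q` of two tracks with at least three symbols each,
and `H = gateGroup` is generated by all symbol permutations, applied in every cell, together with
the left translations of either track. Left translations commute with the shifts, which translate
on the right, so `H ≤ shiftAut G A`.

Conjugating a symbol permutation by a translation of the second track gives a *gate*, which permutes
the first-track symbol of every cell `a` according to the second-track symbol at `b * a`
(`readCell_mem_controls`). The commutator of two gates acts only where both are active, so `H` also
contains gates that are active where two prescribed symbols occur at two prescribed relative
positions (`pairControl_mem_controls`), and commutators of transpositions already move any symbol
to any other one (`exists_commutator_apply_eq`).

Let `seed` be the configuration carrying the symbol `1` on both tracks at the identity of `G` and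
`0` everywhere else. Two facts determine the centralizer.

* A homeomorphism `φ` in the centralizer of `H` sends `seed` to a shift of itself
  (`exists_eq_shiftMap_seed`): every element of `H` fixing `seed` fixes `φ seed`, and conversely.
  Gates looking for a pattern that is absent from `seed` show that each track of `φ seed` uses only
  the symbols `0` and `1`, the latter at most once; further elements of `H` show that the symbols `1`
  of the two tracks sit in the same cell, and that they are not both absent.
* The orbit of `seed` under `H` is dense (`dense_orbit_seed`). The symbol `1` of the second track
  marks one cell, which allows the first track to be rewritten at will in any finite set; writing
  there a pair of symbols that occurs nowhere else in that relative position makes the first track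
  mark a cell, which allows the second track to be rewritten.

If `φ seed = σ_g seed`, then `φ` and `σ_g` agree on the orbit of `seed`, hence everywhere.
-/

section GateGroup

open scoped commutatorElement

variable {G : Type*} [Group G] {A : Type*} [TopologicalSpace A] [DiscreteTopology A]
variable {P Q : Type*}

/-! ### Symbol permutations, track translations and the group they generate -/

/-- The action of a permutation of the alphabet on `A^G`, cell by cell. -/
def symbolHom (G : Type*) (A : Type*) [TopologicalSpace A] [DiscreteTopology A] :
    Equiv.Perm A →* ((G → A) ≃ₜ (G → A)) where
  toFun π :=
    { toFun := fun x a => π (x a)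
      invFun := fun x a => π⁻¹ (x a)
      left_inv := fun x => by simp
      right_inv := fun x => by simp
      continuous_toFun :=
        continuous_pi fun a => continuous_of_discreteTopology.comp (continuous_apply a)
      continuous_invFun :=
        continuous_pi fun a => continuous_of_discreteTopology.comp (continuous_apply a) }
  map_one' := rfl
  map_mul' _ _ := rfl

omit [Group G] in
theorem continuous_splice (e : A ≃ P × Q) (a b : G) :
    Continuous fun x : G → A => e.symm ((e (x a)).1, (e (x b)).2) := by
  have hpair : Continuous fun x : G → A => (x a, x b) := by fun_prop
  have hsplice : Continuous fun z : A × A => e.symm ((e z.1).1, (e z.2).2) :=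
    continuous_of_discreteTopology
  exact hsplice.comp hpair

/-- Left translation by `g` of the second track of `A^G`, with respect to the splitting
`e : A ≃ P × Q` of the alphabet; the first track stays in place. -/
def trackShiftHom (G : Type*) [Group G] (e : A ≃ P × Q) : G →* ((G → A) ≃ₜ (G → A)) where
  toFun g :=
    { toFun := fun x a => e.symm ((e (x a)).1, (e (x (g⁻¹ * a))).2)
      invFun := fun x a => e.symm ((e (x a)).1, (e (x (g * a))).2)
      left_inv := fun x => by simp
      right_inv := fun x => by simp
      continuous_toFun := continuous_pi fun a =>
        continuous_splice e a (g⁻¹ * a)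
      continuous_invFun := continuous_pi fun a =>
        continuous_splice e a (g * a) }
  map_one' := by
    ext x a
    simp
  map_mul' g h := by
    ext x a
    simp [mul_assoc]

/-- The same splitting of the alphabet with the two tracks interchanged. -/
def swapTracks (e : A ≃ P × Q) : A ≃ Q × P := e.trans (Equiv.prodComm P Q)

/-- The group generated by all symbol permutations and all left translations of either track. -/
def gateGroup (G : Type*) [Group G] (e : A ≃ P × Q) : Subgroup ((G → A) ≃ₜ (G → A)) :=
  (symbolHom G A).range ⊔ ((trackShiftHom G e).range ⊔ (trackShiftHom G (swapTracks e)).range)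

theorem gateGroup_swapTracks (e : A ≃ P × Q) :
    gateGroup G (swapTracks e) = gateGroup G e := by
  have h : swapTracks (swapTracks e) = e := rfl
  rw [gateGroup, gateGroup, h, sup_comm (trackShiftHom G e).range]

theorem symbolHom_mem_gateGroup (e : A ≃ P × Q) (π : Equiv.Perm A) :
    symbolHom G A π ∈ gateGroup G e :=
  Subgroup.mem_sup_left ⟨π, rfl⟩

theorem trackShiftHom_mem_gateGroup (e : A ≃ P × Q) (g : G) :
    trackShiftHom G e g ∈ gateGroup G e :=
  Subgroup.mem_sup_right (Subgroup.mem_sup_left ⟨g, rfl⟩)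

theorem gateGroup_le_shiftAut (e : A ≃ P × Q) : gateGroup G e ≤ shiftAut G A := by
  refine sup_le ?_ (sup_le ?_ ?_)
  · rintro _ ⟨π, rfl⟩ g x
    rfl
  · rintro _ ⟨s, rfl⟩ g x
    funext a
    simp [trackShiftHom, shiftMap, mul_assoc]
  · rintro _ ⟨s, rfl⟩ g x
    funext a
    simp [trackShiftHom, shiftMap, mul_assoc]

theorem gateGroup_fg [Finite A] (hG : Group.FG G) (e : A ≃ P × Q) : (gateGroup G e).FG := by
  have hsymbol : (symbolHom G A).range.FG := (Group.fg_iff_subgroup_fg _).1 inferInstance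
  have hsnd : (trackShiftHom G e).range.FG := (Group.fg_iff_subgroup_fg _).1 inferInstance
  have hfst : (trackShiftHom G (swapTracks e)).range.FG :=
    (Group.fg_iff_subgroup_fg _).1 inferInstance
  exact hsymbol.sup (hsnd.sup hfst)

/-! ### Gates -/

/-- The gate with control `κ`: in each cell `a` it applies to the first-track symbol the
permutation that `κ` reads off the second track as seen from `a`, that is off `b ↦ x (b * a)`.
The second track is unchanged. -/
def gate (e : A ≃ P × Q) (κ : (G → Q) → Equiv.Perm P) (x : G → A) : G → A :=
  fun a => e.symm (κ (fun b => (e (x (b * a))).2) (e (x a)).1, (e (x a)).2)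

/-- The controls whose gates belong to `gateGroup G e`. Gates compose by pointwise multiplication
of their controls, since they do not change the track that the controls read. -/
def controls (G : Type*) [Group G] (e : A ≃ P × Q) : Subgroup ((G → Q) → Equiv.Perm P) where
  carrier := {κ | ∃ h ∈ gateGroup G e, ∀ x, h x = gate e κ x}
  one_mem' := ⟨1, one_mem _, fun x => by funext a; simp [gate]⟩
  mul_mem' := by
    rintro κ κ' ⟨h, hh, hκ⟩ ⟨h', hh', hκ'⟩
    refine ⟨h * h', mul_mem hh hh', fun x => ?_⟩
    change h (h' x) = _
    rw [hκ, hκ']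
    funext a
    simp [gate]
  inv_mem' := by
    rintro κ ⟨h, hh, hκ⟩
    refine ⟨h⁻¹, inv_mem hh, fun x => h.injective ?_⟩
    change h (h.symm x) = _
    rw [h.apply_symm_apply, hκ]
    funext a
    simp [gate]

theorem exists_mem_gateGroup {e : A ≃ P × Q} {κ : (G → Q) → Equiv.Perm P}
    (hκ : κ ∈ controls G e) : ∃ h ∈ gateGroup G e, ∀ x, h x = gate e κ x := hκ

/-- Gates reading a single cell belong to the gate group: they are conjugates of symbol permutations
by translations of the second track. -/
theorem readCell_mem_controls (e : A ≃ P × Q) (b : G) (f : Q → Equiv.Perm P) :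
    (fun v => f (v b)) ∈ controls G e := by
  let π : Equiv.Perm A :=
    { toFun := fun z => e.symm (f (e z).2 (e z).1, (e z).2)
      invFun := fun z => e.symm ((f (e z).2)⁻¹ (e z).1, (e z).2)
      left_inv := fun z => by simp
      right_inv := fun z => by simp }
  refine ⟨trackShiftHom G e b * symbolHom G A π * trackShiftHom G e b⁻¹,
    mul_mem (mul_mem (trackShiftHom_mem_gateGroup e _) (symbolHom_mem_gateGroup e _))
      (trackShiftHom_mem_gateGroup e _), fun x => ?_⟩
  funext a
  simp [trackShiftHom, symbolHom, gate, π]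

open Classical in
/-- The control that is active, with value `π`, where the second track carries `q` at relative
position `b` and `q'` at relative position `b'`. -/
noncomputable def pairControl (b b' : G) (q q' : Q) (π : Equiv.Perm P) (v : G → Q) : Equiv.Perm P :=
  if v b = q ∧ v b' = q' then π else 1

theorem pairControl_mem_controls (e : A ≃ P × Q) (b b' : G) (q q' : Q) (π ρ : Equiv.Perm P) :
    pairControl b b' q q' ⁅π, ρ⁆ ∈ controls G e := by
  classical
  have key : pairControl b b' q q' ⁅π, ρ⁆ =
      ⁅(fun v : G → Q => if v b = q then π else 1),
        (fun v : G → Q => if v b' = q' then ρ else 1)⁆ := by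
    funext v
    by_cases h : v b = q <;> by_cases h' : v b' = q' <;>
      simp [pairControl, commutatorElement_def, h, h']
  rw [key, commutatorElement_def]
  have h1 := readCell_mem_controls e b (fun s => if s = q then π else 1)
  have h2 := readCell_mem_controls e b' (fun s => if s = q' then ρ else 1)
  exact mul_mem (mul_mem (mul_mem h1 h2) (inv_mem h1)) (inv_mem h2)

/-- With at least three symbols, commutators of permutations act transitively. -/
theorem exists_commutator_apply_eq {p : Fin 3 → P} (hp : p.Injective) (r s : P) :
    ∃ π ρ : Equiv.Perm P, ⁅π, ρ⁆ r = s := by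
  classical
  by_cases hrs : r = s
  · exact ⟨1, 1, by simp [hrs]⟩
  obtain ⟨t, htr, hts⟩ : ∃ t, t ≠ r ∧ t ≠ s := by
    by_contra! h
    have h01 : p 0 ≠ p 1 := hp.ne (by decide)
    have h02 : p 0 ≠ p 2 := hp.ne (by decide)
    have h12 : p 1 ≠ p 2 := hp.ne (by decide)
    have h' : ∀ i, p i = r ∨ p i = s := fun i => or_iff_not_imp_left.2 (h (p i))
    grind [h' 0, h' 1, h' 2]
  refine ⟨Equiv.swap r s, Equiv.swap r t, ?_⟩
  simp [commutatorElement_def, Equiv.swap_apply_of_ne_of_ne htr hts]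

/-- The configuration with the symbol `1` on both tracks at the identity and `0` elsewhere; the
maps `p` and `q` name the symbols `0`, `1`, `2` of the two tracks. -/
noncomputable def seed (G : Type*) [Group G] (e : A ≃ P × Q) (p : Fin 3 → P) (q : Fin 3 → Q) :
    G → A :=
  open Classical in fun a => if a = 1 then e.symm (p 1, q 1) else e.symm (p 0, q 0)

omit [TopologicalSpace A] [DiscreteTopology A] in
theorem snd_seed (e : A ≃ P × Q) (p : Fin 3 → P) (q : Fin 3 → Q) (a : G) :
    (e (seed G e p q a)).2 = open Classical in if a = 1 then q 1 else q 0 := by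
  by_cases h : a = 1 <;> simp [seed, h]

/-! ### The image of the seed under a commuting homeomorphism -/

/-- A two-cell pattern of the second track that is absent from `x` is absent from `φ x`: the gates
looking for it fix `x`, hence fix `φ x`. -/
theorem pair_absent_of_mem_centralizer {e : A ≃ P × Q} {p : Fin 3 → P} (hp : p.Injective)
    {φ : (G → A) ≃ₜ (G → A)} (hφ : ∀ h ∈ gateGroup G e, ∀ x, h (φ x) = φ (h x))
    {x : G → A} {t : G} {q q' : Q}
    (hx : ∀ a, ¬((e (x a)).2 = q ∧ (e (x (t * a))).2 = q')) (a : G) :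
    ¬((e (φ x a)).2 = q ∧ (e (φ x (t * a))).2 = q') := by
  intro ha
  obtain ⟨s, hs⟩ : ∃ s, s ≠ (e (φ x a)).1 := by
    by_contra! h
    exact hp.ne (by decide : (0 : Fin 3) ≠ 1) ((h _).trans (h _).symm)
  obtain ⟨π, ρ, hπ⟩ := exists_commutator_apply_eq hp (e (φ x a)).1 s
  obtain ⟨h, hh, hgate⟩ := exists_mem_gateGroup (pairControl_mem_controls e 1 t q q' π ρ)
  have hfix : h x = x := by
    rw [hgate]
    funext c
    simp [gate, pairControl, hx c]
  have hfix' := hφ h hh x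
  rw [hfix, hgate] at hfix'
  have := congrArg (fun y => (e (y a)).1) hfix'
  simp only [gate, pairControl, one_mul, ha, and_self, if_true, Equiv.apply_symm_apply, hπ] at this
  exact hs this

theorem snd_image_seed {e : A ≃ P × Q} {p : Fin 3 → P} (hp : p.Injective) {q : Fin 3 → Q}
    {φ : (G → A) ≃ₜ (G → A)} (hφ : ∀ h ∈ gateGroup G e, ∀ x, h (φ x) = φ (h x)) (a : G) :
    (e (φ (seed G e p q) a)).2 = q 0 ∨ (e (φ (seed G e p q) a)).2 = q 1 := by
  by_contra! h
  refine pair_absent_of_mem_centralizer hp hφ (x := seed G e p q) (t := 1)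
    (q := (e (φ (seed G e p q) a)).2) (q' := (e (φ (seed G e p q) a)).2) ?_ a ⟨rfl, by rw [one_mul]⟩
  rintro c ⟨hc, -⟩
  rw [snd_seed] at hc
  split_ifs at hc
  · exact h.2 hc.symm
  · exact h.1 hc.symm

theorem snd_image_seed_unique {e : A ≃ P × Q} {p : Fin 3 → P} (hp : p.Injective)
    {q : Fin 3 → Q} (hq : q.Injective)
    {φ : (G → A) ≃ₜ (G → A)} (hφ : ∀ h ∈ gateGroup G e, ∀ x, h (φ x) = φ (h x)) {a b : G}
    (ha : (e (φ (seed G e p q) a)).2 = q 1) (hb : (e (φ (seed G e p q) b)).2 = q 1) : b = a := by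
  by_contra hab
  refine pair_absent_of_mem_centralizer hp hφ (x := seed G e p q) (t := b * a⁻¹)
    (q := q 1) (q' := q 1) ?_ a ⟨ha, by simpa using hb⟩
  rintro c ⟨hc, hc'⟩
  have h01 : q 0 ≠ q 1 := hq.ne (by decide)
  rw [snd_seed] at hc hc'
  have h1 : c = 1 := by
    by_contra h
    simp [h, h01] at hc
  have h2 : b * a⁻¹ * c = 1 := by
    by_contra h
    simp [h, h01] at hc'
  rw [h1, mul_one, mul_inv_eq_one] at h2
  exact hab h2

/-- Where the second track of `φ seed` carries `1`, so does the first: the gate exchanging `0` and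
`2` on the first track below each `1` of the second fixes `seed`. -/
theorem fst_image_seed_of_snd {e : A ≃ P × Q} {p : Fin 3 → P} (hp : p.Injective)
    {q : Fin 3 → Q} (hq : q.Injective)
    {φ : (G → A) ≃ₜ (G → A)} (hφ : ∀ h ∈ gateGroup G e, ∀ x, h (φ x) = φ (h x)) {a : G}
    (ha : (e (φ (seed G e p q) a)).2 = q 1) : (e (φ (seed G e p q) a)).1 = p 1 := by
  classical
  have h01 : q 0 ≠ q 1 := hq.ne (by decide)
  have hp01 : p 1 ≠ p 0 := hp.ne (by decide)
  have hp12 : p 1 ≠ p 2 := hp.ne (by decide)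
  have hp02 : p 2 ≠ p 0 := hp.ne (by decide)
  have hφ' : ∀ h ∈ gateGroup G (swapTracks e), ∀ x, h (φ x) = φ (h x) := by
    rwa [gateGroup_swapTracks]
  refine (snd_image_seed hq hφ' a).resolve_left fun h0 => ?_
  change (e (φ (seed G e p q) a)).1 = p 0 at h0
  obtain ⟨h, hh, hgate⟩ := exists_mem_gateGroup
    (readCell_mem_controls e (1 : G) fun s => if s = q 1 then Equiv.swap (p 0) (p 2) else 1)
  have hfix : h (seed G e p q) = seed G e p q := by
    rw [hgate]
    funext c
    by_cases hc : c = 1 <;>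
      simp [gate, seed, hc, h01, Equiv.swap_apply_of_ne_of_ne hp01 hp12]
  have hfix' := hφ h hh (seed G e p q)
  rw [hfix, hgate] at hfix'
  have := congrArg (fun y => (e (y a)).1) hfix'
  simp [gate, ha, h0] at this
  exact hp02 this

/-- A homeomorphism commuting with the gate group maps the seed into its orbit under shifts. -/
theorem exists_eq_shiftMap_seed {e : A ≃ P × Q} {p : Fin 3 → P} (hp : p.Injective)
    {q : Fin 3 → Q} (hq : q.Injective)
    {φ : (G → A) ≃ₜ (G → A)} (hφ : ∀ h ∈ gateGroup G e, ∀ x, h (φ x) = φ (h x)) :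
    ∃ g : G, φ (seed G e p q) = shiftMap g (seed G e p q) := by
  classical
  have hφ' : ∀ h ∈ gateGroup G (swapTracks e), ∀ x, h (φ x) = φ (h x) := by
    rwa [gateGroup_swapTracks]
  have hsnd := snd_image_seed (q := q) hp hφ
  have hfst : ∀ a, (e (φ (seed G e p q) a)).1 = p 0 ∨ (e (φ (seed G e p q) a)).1 = p 1 :=
    snd_image_seed hq hφ'
  have hsnd_of_fst : ∀ {a}, (e (φ (seed G e p q) a)).1 = p 1 →
      (e (φ (seed G e p q) a)).2 = q 1 := fun {a} h => fst_image_seed_of_snd hq hp hφ' (a := a) h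
  obtain ⟨g, hg⟩ : ∃ g, (e (φ (seed G e p q) g)).2 = q 1 := by
    by_contra! hnone
    have hzero : ∀ a, φ (seed G e p q) a = e.symm (p 0, q 0) := by
      intro a
      rw [Equiv.eq_symm_apply]
      exact Prod.ext ((hfst a).resolve_right fun h => hnone a (hsnd_of_fst h))
        ((hsnd a).resolve_right (hnone a))
    -- The exchange of the symbols `(1, 1)` and `(2, 2)` fixes the zero configuration, so it would
    -- have to fix the seed.
    have hmove := hφ _ (symbolHom_mem_gateGroup e
      (Equiv.swap (e.symm (p 1, q 1)) (e.symm (p 2, q 2)))) (seed G e p q)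
    have hp01 : p 0 ≠ p 1 := hp.ne (by decide)
    have hp02 : p 0 ≠ p 2 := hp.ne (by decide)
    have hp21 : p 2 ≠ p 1 := hp.ne (by decide)
    have hfix : symbolHom G A (Equiv.swap (e.symm (p 1, q 1)) (e.symm (p 2, q 2)))
        (φ (seed G e p q)) = φ (seed G e p q) := by
      funext a
      change Equiv.swap _ _ (φ (seed G e p q) a) = _
      rw [hzero a]
      exact Equiv.swap_apply_of_ne_of_ne (by simp [hp01]) (by simp [hp02])
    rw [hfix] at hmove
    have := congrFun (φ.injective hmove) 1
    simp [seed, symbolHom, hp21.symm] at this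
  refine ⟨g⁻¹, ?_⟩
  funext a
  apply e.injective
  by_cases ha : a = g
  · subst ha
    simpa [shiftMap, seed] using Prod.ext (fst_image_seed_of_snd hp hq hφ hg) hg
  · have h2 : (e (φ (seed G e p q) a)).2 ≠ q 1 := fun h =>
      ha (snd_image_seed_unique hp hq hφ hg h)
    have h1 : (e (φ (seed G e p q) a)).1 ≠ p 1 := fun h => h2 (hsnd_of_fst h)
    simpa [shiftMap, seed, mul_inv_eq_one, ha] using
      Prod.ext ((hfst a).resolve_right h1) ((hsnd a).resolve_right h2)

/-! ### Density of the orbit of the seed -/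

open Classical in
/-- If a two-cell pattern of the second track marks a single cell `c` of `x`, then the gate group
can rewrite the first track of `x` arbitrarily on any finite set. -/
theorem exists_rewrite_fst {e : A ≃ P × Q} {p : Fin 3 → P} (hp : p.Injective) {x : G → A}
    {c t : G} {q q' : Q} (hc : ∀ a, ((e (x a)).2 = q ∧ (e (x (t * a))).2 = q') ↔ a = c)
    (W : Finset G) (r : G → P) :
    ∃ h ∈ gateGroup G e, h x = fun a => if a ∈ W then e.symm (r a, (e (x a)).2) else x a := by
  induction W using Finset.induction_on with
  | empty => exact ⟨1, one_mem _, by simp⟩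
  | insert d W hd ih =>
    obtain ⟨h, hh, hx⟩ := ih
    obtain ⟨π, ρ, hπ⟩ := exists_commutator_apply_eq hp (e (x d)).1 (r d)
    -- Read the marked pattern at `c` from the cell `d`.
    obtain ⟨h', hh', hgate⟩ := exists_mem_gateGroup
      (pairControl_mem_controls e (c * d⁻¹) (t * (c * d⁻¹)) q q' π ρ)
    refine ⟨h' * h, mul_mem hh' hh, ?_⟩
    change h' (h x) = _
    have hsnd : ∀ a, (e (h x a)).2 = (e (x a)).2 := by
      intro a
      rw [hx]
      by_cases ha : a ∈ W <;> simp [ha]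
    rw [hgate]
    funext a
    have hiff : ((e (x (c * d⁻¹ * a))).2 = q ∧ (e (x (t * (c * d⁻¹) * a))).2 = q') ↔ a = d := by
      rw [mul_assoc t, hc, mul_assoc, mul_eq_left, inv_mul_eq_one, eq_comm]
    simp only [gate, pairControl, hsnd, hiff]
    by_cases ha : a = d
    · subst ha
      simp [hx, hd, hπ]
    · by_cases haW : a ∈ W <;> simp [hx, ha, haW]

omit [Group G] [DiscreteTopology A] in
/-- A set of configurations realising every finite pattern is dense. -/
theorem dense_of_forall_exists_eqOn {S : Set (G → A)}
    (hS : ∀ (z : G → A) (W : Finset G), ∃ x ∈ S, ∀ a ∈ W, x a = z a) : Dense S := by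
  intro z
  rw [mem_closure_iff]
  intro o ho hz
  obtain ⟨W, u, hu, hsub⟩ := isOpen_pi_iff.1 ho z hz
  obtain ⟨x, hxS, hx⟩ := hS z W
  exact ⟨x, hsub fun a ha => by rw [hx a ha]; exact (hu a ha).2, hxS⟩

theorem dense_orbit_seed [Infinite G] {e : A ≃ P × Q} {p : Fin 3 → P} (hp : p.Injective)
    {q : Fin 3 → Q} (hq : q.Injective) :
    Dense {y | ∃ h ∈ gateGroup G e, h (seed G e p q) = y} := by
  classical
  refine dense_of_forall_exists_eqOn fun z W₀ => ?_
  -- The window contains the identity, so that the mark of the seed's first track is overwritten.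
  let W := insert 1 W₀
  obtain ⟨t, ht⟩ := Infinite.exists_notMem_finset (Finset.image₂ (fun a b => a * b⁻¹) W W)
  obtain ⟨c, hc⟩ := Infinite.exists_notMem_finset (W ∪ W.image fun a => t⁻¹ * a)
  have htW : ∀ a ∈ W, t * a ∉ W := fun a ha hta =>
    ht (Finset.mem_image₂.2 ⟨t * a, hta, a, ha, by simp⟩)
  have ht1 : t * c ≠ c := fun h => htW 1 (Finset.mem_insert_self _ _) (by
    rw [mul_eq_right.1 h, mul_one]; exact Finset.mem_insert_self _ _)
  have hcW : c ∉ W := fun h => hc (Finset.mem_union_left _ h)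
  have htcW : t * c ∉ W := fun h =>
    hc (Finset.mem_union_right _ (Finset.mem_image.2 ⟨t * c, h, by simp⟩))
  have hq01 : q 0 ≠ q 1 := hq.ne (by decide)
  have hp01 : p 0 ≠ p 1 := hp.ne (by decide)
  have hp02 : p 0 ≠ p 2 := hp.ne (by decide)
  have hp12 : p 1 ≠ p 2 := hp.ne (by decide)
  -- Outside the window, the first track will carry `1` at `c` and `2` at `t * c` only.
  let r : G → P := fun a =>
    if a ∈ W then (e (z a)).1 else if a = c then p 1 else if a = t * c then p 2 else p 0
  obtain ⟨h, hh, hx⟩ := exists_rewrite_fst hp (x := seed G e p q) (c := 1) (t := 1)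
    (q := q 1) (q' := q 1) (fun a => by
      rw [one_mul, and_self, snd_seed]
      by_cases ha : a = 1 <;> simp [ha, hq01]) (insert c (insert (t * c) W)) r
  have hfst : ∀ a, (e (h (seed G e p q) a)).1 = r a := by
    intro a
    rw [hx]
    by_cases ha : a ∈ insert c (insert (t * c) W)
    · simp [ha]
    · have ha' := ha
      simp only [Finset.mem_insert, not_or] at ha'
      have ha1 : a ≠ 1 := fun h => ha'.2.2 (h ▸ Finset.mem_insert_self _ _)
      simp [r, ha', seed, ha1]
  have hmark : ∀ a, ((swapTracks e (h (seed G e p q) a)).2 = p 1 ∧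
      (swapTracks e (h (seed G e p q) (t * a))).2 = p 2) ↔ a = c := by
    intro a
    change ((e (h (seed G e p q) a)).1 = p 1 ∧ (e (h (seed G e p q) (t * a))).1 = p 2) ↔ a = c
    rw [hfst, hfst]
    constructor
    · rintro ⟨h1, h2⟩
      by_cases haW : a ∈ W
      · by_contra hac
        simp only [r, htW a haW, if_false, mul_right_inj, hac] at h2
        split_ifs at h2
        · exact hp12 h2
        · exact hp02 h2
      · simp only [r, haW, if_false] at h1
        split_ifs at h1 with hac
        · exact hac
        · exact absurd h1.symm hp12
        · exact absurd h1 hp01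
    · rintro rfl
      simp [r, hcW, htcW, ht1]
  obtain ⟨h', hh', hy⟩ := exists_rewrite_fst hq hmark W fun a => (e (z a)).2
  rw [gateGroup_swapTracks] at hh'
  refine ⟨h' (h (seed G e p q)), ⟨h' * h, mul_mem hh' hh, rfl⟩, fun a ha => ?_⟩
  have haW : a ∈ W := Finset.mem_insert_of_mem ha
  rw [hy]
  change (if a ∈ W then e.symm ((e (h (seed G e p q) a)).1, (e (z a)).2) else _) = _
  simp [haW, hfst, r]

/-! ### The centralizer -/

theorem centralizer_gateGroup [Infinite G] {e : A ≃ P × Q} {p : Fin 3 → P} (hp : p.Injective)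
    {q : Fin 3 → Q} (hq : q.Injective) :
    Subgroup.centralizer (gateGroup G e : Set ((G → A) ≃ₜ (G → A))) = shiftGroup G A := by
  apply le_antisymm
  · intro φ hφ
    rw [Subgroup.mem_centralizer_iff] at hφ
    have hφ' : ∀ h ∈ gateGroup G e, ∀ x, h (φ x) = φ (h x) := fun h hh x =>
      DFunLike.congr_fun (hφ h hh) x
    obtain ⟨g, hg⟩ := exists_eq_shiftMap_seed hp hq hφ'
    refine ⟨g, Homeomorph.ext fun x => ?_⟩
    change shiftMap g x = φ x
    refine congrFun (Continuous.ext_on (dense_orbit_seed (e := e) hp hq)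
      (shiftMap g).continuous φ.continuous ?_) x
    rintro _ ⟨h, hh, rfl⟩
    rw [← hφ' h hh, hg, gateGroup_le_shiftAut e hh g]
  · rintro _ ⟨g, rfl⟩
    rw [Subgroup.mem_centralizer_iff]
    intro h hh
    exact Homeomorph.ext fun x => gateGroup_le_shiftAut e hh g x

end GateGroup

theorem mainTheorem4 {G : Type*} [Group G] [Infinite G] (hG : Group.FG G)
    {A : Type*} [Finite A] [TopologicalSpace A] [DiscreteTopology A]
    (m k : ℕ) (hm : 5 ≤ m) (hk : 4 ≤ k) (hA : Nat.card A = m ^ k) :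
    ∃ H : Subgroup ((G → A) ≃ₜ (G → A)),
      H ≤ shiftAut G A ∧ H.FG ∧
      Subgroup.centralizer (H : Set ((G → A) ≃ₜ (G → A))) = shiftGroup G A ∧
      Subgroup.centralizer (H : Set ((G → A) ≃ₜ (G → A))) ⊓ shiftAut G A =
        shiftGroup G A ⊓ shiftAut G A := by
  have hm3 : 3 ≤ m := by omega
  have hmk : 3 ≤ m ^ (k - 1) := hm3.trans (Nat.le_self_pow (by omega) m)
  have hcard : Nat.card A = Nat.card (Fin m × Fin (m ^ (k - 1))) := by
    rw [hA, Nat.card_prod, Nat.card_fin, Nat.card_fin, ← pow_succ']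
    congr 1
    omega
  obtain ⟨e⟩ : Nonempty (A ≃ Fin m × Fin (m ^ (k - 1))) := Finite.card_eq.1 hcard
  have hC : Subgroup.centralizer (gateGroup G e : Set ((G → A) ≃ₜ (G → A))) = shiftGroup G A :=
    centralizer_gateGroup (Fin.castLE_injective hm3) (Fin.castLE_injective hmk)
  exact ⟨gateGroup G e, gateGroup_le_shiftAut e, gateGroup_fg hG e, hC, by rw [hC]⟩
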